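/- Let $\mathbb K$ be $\mathbb R$ or $\mathbb C$, and let $r,d\ge 1$ be integers. Equip the set of ordered $r$-tuples $\mathcal A=(A_1,\dots,A_r)$ of $d\times d$ matrices over $\mathbb K$ with the metric $\max_{1\le i\le r}\|A_i-B_i\|$, where $\|\cdot\|$ is the operator norm induced by the Euclidean norm on $\mathbb K^d$. Let $\mathcal I_r(\mathbb K^d)$ be the subspace of irreducible tuples, that is, those for which no linear subspace $V\subset\mathbb K^d$ other than $\{0\}$ and $\mathbb K^d$ satisfies $A_iV\subset V$ for every $i$. For $n\ge 1$ put $\mathcal A_n=\{A_{i_n}\cdots A_{i_1}: 1\le i_1,\dots,i_n\le r\}$, and let $\varrho(\mathcal A)=\lim_{n\to\infty}\max\{\|B\|^{1/n}: B\in\mathcal A_n\}$ be the joint spectral radius. The tuple $\mathcal A$ is said to have the rank one property if (i) $\varrho(\mathcal A)>0$ and the set $\bigcup_{n\ge 1}\varrho(\mathcal A)^{-n}\mathcal A_n$ is bounded, and (ii) every nonzero element of the limit semigroup $\mathcal S(\mathcal A)=\bigcap_{m\ge 1}\overline{\bigcup_{n\ge m}\varrho(\mathcal A)^{-n}\mathcal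 A_n}$ has rank one. Then for all integers $d,r\ge 1$ the set of all $\mathcal A\in\mathcal I_r(\mathbb K^d)$ having the rank one property is open in $\mathcal I_r(\mathbb K^d)$. In the particular case $\mathbb K=\mathbb C$, $d=2$, this set is also dense in $\mathcal I_r(\mathbb C^2)$, for every $r\ge 1$. -/

import Mathlib

open Filter Topology

-- Matrices carry the operator norm coming from the Euclidean norm.  Consequently `Fin r → Matrix …`
-- carries the metric `max_i ‖A i - B i‖`, and the induced (product) topology.
open scoped Matrix.Norms.L2Operator

noncomputable section

namespace JointSpectral

variable {𝕜 : Type*} [RCLike 𝕜] {r d : ℕ}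

/-- The product `A_{i_n} ⋯ A_{i_1}` determined by the word `w = (i_1, …, i_n)`. -/
def wordProd (A : Fin r → Matrix (Fin d) (Fin d) 𝕜) {n : ℕ} (w : Fin n → Fin r) :
    Matrix (Fin d) (Fin d) 𝕜 :=
  (List.ofFn fun k => A (w k)).reverse.prod

/-- The set `𝒜_n` of all products of length `n` of the matrices of the tuple. -/
def products (A : Fin r → Matrix (Fin d) (Fin d) 𝕜) (n : ℕ) : Set (Matrix (Fin d) (Fin d) 𝕜) :=
  Set.range fun w : Fin n → Fin r => wordProd A w

/-- `sup ‖A_{i_n} ⋯ A_{i_1}‖^{1/n}` over all words of length `n`. -/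
def growth (A : Fin r → Matrix (Fin d) (Fin d) 𝕜) (n : ℕ) : ℝ :=
  ⨆ w : Fin n → Fin r, ‖wordProd A w‖ ^ (1 / (n : ℝ))

/-- The joint spectral radius
`lim_{n → ∞} sup ‖A_{i_n} ⋯ A_{i_1}‖^{1/n}`; the limit exists, see `tendsto_growth`. -/
def jsr (A : Fin r → Matrix (Fin d) (Fin d) 𝕜) : ℝ :=
  limUnder atTop (growth A)

/-- The tuple is irreducible: no linear subspace other than `0` and the whole space is preserved by
all its matrices. -/
def IsIrreducibleTuple (A : Fin r → Matrix (Fin d) (Fin d) 𝕜) : Prop :=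
  ∀ V : Submodule 𝕜 (Fin d → 𝕜), (∀ i, ∀ v ∈ V, (A i).mulVec v ∈ V) → V = ⊥ ∨ V = ⊤

/-- The set `ℐ_r(𝕜^d)` of irreducible `r`-tuples of `d × d` matrices over `𝕜`. -/
def irreducibleTuples (𝕜 : Type*) [RCLike 𝕜] (r d : ℕ) :
    Set (Fin r → Matrix (Fin d) (Fin d) 𝕜) :=
  {A | IsIrreducibleTuple A}

/-- The set of all products of positive length is bounded. -/
def ProductBounded (A : Fin r → Matrix (Fin d) (Fin d) 𝕜) : Prop :=
  Bornology.IsBounded (⋃ n ∈ Set.Ici 1, products A n)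

/-- The joint spectral radius is positive and the normalised tuple is product bounded. -/
def RelativelyProductBounded (A : Fin r → Matrix (Fin d) (Fin d) 𝕜) : Prop :=
  0 < jsr A ∧ ProductBounded fun i => (jsr A)⁻¹ • A i

/-- The limit semigroup `⋂_{m ≥ 1} closure (⋃_{n ≥ m} ϱ(A)^{-n} 𝒜_n)`. -/
def limitSemigroup (A : Fin r → Matrix (Fin d) (Fin d) 𝕜) : Set (Matrix (Fin d) (Fin d) 𝕜) :=
  ⋂ m ∈ Set.Ici 1, closure (⋃ n ∈ Set.Ici m, (fun B => ((jsr A) ^ n)⁻¹ • B) '' products A n)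

/-- The rank one property. -/
def RankOneProperty (A : Fin r → Matrix (Fin d) (Fin d) 𝕜) : Prop :=
  RelativelyProductBounded A ∧ ∀ B ∈ limitSemigroup A, B ≠ 0 → B.rank = 1

/-- If `c n ≥ 0` and `n ↦ c n ^ n` is submultiplicative then `c` converges. -/
theorem exists_tendsto_of_submul (c : ℕ → ℝ) (h0 : ∀ n, 0 ≤ c n)
    (h : ∀ m n, 1 ≤ m → 1 ≤ n → c (m + n) ^ (m + n) ≤ c m ^ m * c n ^ n) :
    ∃ l, Tendsto c atTop (𝓝 l) := by
  have key : ∀ n, 1 ≤ n → ∀ L, c n < L → ∀ᶠ p in atTop, c p < L := by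
    intro n hn L hL
    obtain ⟨δ, hδ1, hδ2⟩ := exists_between ((h0 n).trans_lt hL)
    set u : ℕ → ℝ := fun p => p * Real.log (max (c p) δ) with hu
    have hpos : ∀ p, 0 < max (c p) δ := fun p => lt_max_of_lt_right hδ1
    have hup : ∀ p, u p = Real.log (max (c p) δ ^ p) := fun p => by rw [Real.log_pow]
    have hsub : Subadditive u := by
      intro p q
      rcases Nat.eq_zero_or_pos p with rfl | hp
      · simp [hu]
      rcases Nat.eq_zero_or_pos q with rfl | hq
      · simp [hu]
      rw [hup, hup, hup, ← Real.log_mul (pow_pos (hpos _) _).ne' (pow_pos (hpos _) _).ne']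
      apply Real.log_le_log (pow_pos (hpos _) _)
      rcases le_total (c (p + q)) δ with hc | hc
      · rw [max_eq_right hc, pow_add]
        gcongr
        · exact le_max_right _ _
        · exact le_max_right _ _
      · rw [max_eq_left hc]
        refine (h p q hp hq).trans ?_
        have := h0 p
        have := h0 q
        gcongr
        · exact le_max_left _ _
        · exact le_max_left _ _
    have hdiv : ∀ p, 1 ≤ p → u p / p = Real.log (max (c p) δ) := by
      intro p hp
      have : (p : ℝ) ≠ 0 := by positivity
      simp only [hu]
      field_simp
    have hlt : u n / n < Real.log L := by
      rw [hdiv n hn]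
      exact Real.log_lt_log (hpos n) (max_lt hL hδ2)
    filter_upwards [hsub.eventually_div_lt_of_div_lt (by omega) hlt, eventually_ge_atTop 1]
      with p hp hp1
    rw [hdiv p hp1] at hp
    exact (le_max_left _ _).trans_lt
      ((Real.log_lt_log_iff (hpos p) ((h0 n).trans_lt hL)).1 hp)
  have hbdd : BddBelow (c '' Set.Ici 1) := ⟨0, by rintro _ ⟨n, -, rfl⟩; exact h0 n⟩
  refine ⟨sInf (c '' Set.Ici 1), tendsto_order.2 ⟨fun a ha => ?_, fun a ha => ?_⟩⟩
  · filter_upwards [eventually_ge_atTop 1] with p hp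
    exact ha.trans_le (csInf_le hbdd ⟨p, hp, rfl⟩)
  · obtain ⟨_, ⟨n, hn, rfl⟩, hlt⟩ := exists_lt_of_csInf_lt ((Set.nonempty_Ici (a := 1)).image c) ha
    exact key n hn a hlt

theorem growth_nonneg (A : Fin r → Matrix (Fin d) (Fin d) 𝕜) (n : ℕ) : 0 ≤ growth A n :=
  Real.iSup_nonneg fun _ => Real.rpow_nonneg (norm_nonneg _) _

/-- The limit defining the joint spectral radius exists. -/
theorem tendsto_growth (A : Fin r → Matrix (Fin d) (Fin d) 𝕜) :
    Tendsto (growth A) atTop (𝓝 (jsr A)) := by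
  have hle : ∀ n, 1 ≤ n → ∀ w : Fin n → Fin r, ‖wordProd A w‖ ≤ growth A n ^ n := by
    intro n hn w
    have h1 : ‖wordProd A w‖ ^ (1 / (n : ℝ)) ≤ growth A n :=
      le_ciSup (f := fun w : Fin n → Fin r => ‖wordProd A w‖ ^ (1 / (n : ℝ)))
        (Set.finite_range _).bddAbove w
    calc ‖wordProd A w‖ = (‖wordProd A w‖ ^ (1 / (n : ℝ))) ^ n := by
          rw [one_div, Real.rpow_inv_natCast_pow (norm_nonneg _) (by omega)]
      _ ≤ _ := by gcongr
  refine tendsto_nhds_limUnder (exists_tendsto_of_submul _ (growth_nonneg A) fun m n hm hn => ?_)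
  have hnn : 0 ≤ growth A m ^ m * growth A n ^ n :=
    mul_nonneg (pow_nonneg (growth_nonneg A m) m) (pow_nonneg (growth_nonneg A n) n)
  have hg : growth A (m + n) ≤ (growth A m ^ m * growth A n ^ n) ^ (1 / ((m + n : ℕ) : ℝ)) := by
    refine Real.iSup_le (fun w => ?_) (Real.rpow_nonneg hnn _)
    refine Real.rpow_le_rpow (norm_nonneg _) ?_ (by positivity)
    have hw : wordProd A w = wordProd A (fun k : Fin n => w (Fin.natAdd m k)) *
        wordProd A (fun k : Fin m => w (Fin.castAdd n k)) := by
      simp only [wordProd]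
      rw [List.ofFn_add, List.reverse_append, List.prod_append]
      rfl
    rw [hw, mul_comm (growth A m ^ m)]
    exact (norm_mul_le _ _).trans (mul_le_mul (hle n hn _) (hle m hm _) (norm_nonneg _)
      (pow_nonneg (growth_nonneg A n) n))
  calc growth A (m + n) ^ (m + n)
      ≤ ((growth A m ^ m * growth A n ^ n) ^ (1 / ((m + n : ℕ) : ℝ))) ^ (m + n) := by
        gcongr
        exact growth_nonneg A _
    _ = _ := by rw [one_div, Real.rpow_inv_natCast_pow hnn (by omega)]

end JointSpectral

end

/-!
Write `ϱ` for the joint spectral radius of the tuple `A`. The whole argument rests on a criterion: an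
irreducible tuple has the rank one property if and only if `ϱ > 0` and there is a length `n ≥ 1` such
that `‖compound P‖ < ϱ ^ (2 * n)` for all products `P` of length `n`, where `compound` is the matrix
of `2 × 2` minors. Indeed `compound` is multiplicative, and it vanishes exactly on the matrices of
rank at most one. If the inequality holds at one length, then the compounds of the normalised products
decay exponentially and vanish on the limit semigroup (`rankOneProperty_of_norm_compound_lt`). If it
fails at every length, the normalised offending products accumulate at an element of the limit
semigroup with nonzero compound (`RankOneProperty.exists_norm_compound_lt`).

For a fixed length the criterion consists of finitely many strict inequalities, so it is an open
condition as soon as `ϱ` is lower semicontinuous at irreducible tuples. This follows from a uniform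
form of irreducibility: by compactness of the unit sphere, for all tuples `A'` near `A` any two
matrices can be joined by a word of bounded length without losing more than a constant factor of the
product of their norms. Iterating this gives `‖P‖ ≤ K * ϱ(A') ^ n` for all products `P` of length `n`
of `A'`, with `K` uniform near `A` (`IsIrreducibleTuple.eventually_norm_listProd_le`). The bound makes
irreducible tuples with `ϱ > 0` relatively product bounded, and it passes to limits, which gives the semicontinuity
(`IsIrreducibleTuple.eventually_lt_jsr`).

For `2 × 2` matrices the compound is the determinant times a fixed matrix, and the criterion follows from
`|det A_i| < ϱ ^ 2` for all `i`. To reach it, take the matrix `A_i` with the largest `|det A_i|` and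
increase the modulus of its larger eigenvalue `a` slightly, keeping the smaller one `c` fixed. The new
eigenvalue `a'` satisfies `|a'| ≤ ϱ`, while all the determinants are bounded by
`|a'| * |c| < |a'| ^ 2`. Irreducibility survives small perturbations, again by its uniform form.
-/

noncomputable section

namespace JointSpectral

/-! ### Products along words and the joint spectral radius -/

section Words

variable {𝕜 : Type*} [RCLike 𝕜] {r d : ℕ}

/-- The product `A_{l_1} ⋯ A_{l_n}` along a list of indices, read from left to right. Compared with
`wordProd` the order is reversed, so that concatenation of lists becomes multiplication. -/
def listProd (A : Fin r → Matrix (Fin d) (Fin d) 𝕜) (l : List (Fin r)) :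
    Matrix (Fin d) (Fin d) 𝕜 :=
  (l.map A).prod

@[simp]
theorem listProd_nil (A : Fin r → Matrix (Fin d) (Fin d) 𝕜) : listProd A [] = 1 := rfl

@[simp]
theorem listProd_cons (A : Fin r → Matrix (Fin d) (Fin d) 𝕜) (i : Fin r) (l : List (Fin r)) :
    listProd A (i :: l) = A i * listProd A l := by
  simp [listProd]

theorem listProd_append (A : Fin r → Matrix (Fin d) (Fin d) 𝕜) (l l' : List (Fin r)) :
    listProd A (l ++ l') = listProd A l * listProd A l' := by
  simp [listProd]

theorem wordProd_eq_listProd (A : Fin r → Matrix (Fin d) (Fin d) 𝕜) {n : ℕ} (w : Fin n → Fin r) :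
    wordProd A w = listProd A (List.ofFn w).reverse := by
  rw [wordProd, listProd, List.map_reverse, List.map_ofFn]
  rfl

theorem products_eq (A : Fin r → Matrix (Fin d) (Fin d) 𝕜) (n : ℕ) :
    products A n = {B | ∃ l : List (Fin r), l.length = n ∧ listProd A l = B} := by
  ext B
  constructor
  · rintro ⟨w, rfl⟩
    exact ⟨(List.ofFn w).reverse, by simp, (wordProd_eq_listProd A w).symm⟩
  · rintro ⟨l, rfl, rfl⟩
    have h : (List.ofFn fun k : Fin l.length => l.reverse.get (k.cast (by simp))) = l.reverse := by
      apply List.ext_get <;> simp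
    exact ⟨fun k => l.reverse.get (k.cast (by simp)), by
      simp only [wordProd_eq_listProd, h, List.reverse_reverse]⟩

theorem continuous_listProd (l : List (Fin r)) :
    Continuous fun A : Fin r → Matrix (Fin d) (Fin d) 𝕜 => listProd A l := by
  induction l with
  | nil => exact continuous_const
  | cons i l ih =>
    simp only [listProd_cons]
    exact (continuous_apply i).mul ih

theorem norm_listProd_le (A : Fin r → Matrix (Fin d) (Fin d) 𝕜) {R : ℝ} (hR : ∀ i, ‖A i‖ ≤ R)
    (l : List (Fin r)) :
    ‖listProd A l‖ ≤ ‖(1 : Matrix (Fin d) (Fin d) 𝕜)‖ * R ^ l.length := by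
  induction l with
  | nil => simp
  | cons i l ih =>
    have hR0 : 0 ≤ R := (norm_nonneg _).trans (hR i)
    calc ‖listProd A (i :: l)‖ ≤ ‖A i‖ * ‖listProd A l‖ := by
          rw [listProd_cons]; exact norm_mul_le _ _
      _ ≤ R * (‖(1 : Matrix (Fin d) (Fin d) 𝕜)‖ * R ^ l.length) := by
          gcongr
          exact hR i
      _ = _ := by rw [List.length_cons]; ring

theorem listProd_smul (A : Fin r → Matrix (Fin d) (Fin d) 𝕜) (c : ℝ) (l : List (Fin r)) :
    listProd (fun i => c • A i) l = c ^ l.length • listProd A l := by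
  induction l with
  | nil => simp
  | cons i l ih =>
    rw [listProd_cons, ih, listProd_cons, List.length_cons, smul_mul_smul_comm, pow_succ']

theorem norm_real_smul {m n : Type*} [Fintype m] [Fintype n] [DecidableEq n]
    (c : ℝ) (M : Matrix m n 𝕜) : ‖c • M‖ = |c| * ‖M‖ := by
  rw [RCLike.real_smul_eq_coe_smul (K := 𝕜) c M, norm_smul, RCLike.norm_ofReal]

theorem norm_listProd_le_growth_pow (A : Fin r → Matrix (Fin d) (Fin d) 𝕜) {l : List (Fin r)}
    (hl : 1 ≤ l.length) : ‖listProd A l‖ ≤ growth A l.length ^ l.length := by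
  have hmem : listProd A l ∈ products A l.length := by
    rw [products_eq]
    exact ⟨l, rfl, rfl⟩
  obtain ⟨w, hw⟩ := hmem
  have h1 : ‖wordProd A w‖ ^ (1 / (l.length : ℝ)) ≤ growth A l.length :=
    le_ciSup (f := fun w : Fin l.length → Fin r => ‖wordProd A w‖ ^ (1 / (l.length : ℝ)))
      (Set.finite_range _).bddAbove w
  calc ‖listProd A l‖ = (‖wordProd A w‖ ^ (1 / (l.length : ℝ))) ^ l.length := by
        rw [one_div, Real.rpow_inv_natCast_pow (norm_nonneg _) (by omega), ← hw]
    _ ≤ _ := by gcongr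

theorem jsr_nonneg (A : Fin r → Matrix (Fin d) (Fin d) 𝕜) : 0 ≤ jsr A :=
  ge_of_tendsto' (tendsto_growth A) (growth_nonneg A)

theorem jsr_le_of_norm_le (A : Fin r → Matrix (Fin d) (Fin d) 𝕜) {C c : ℝ} (hc : 0 ≤ c)
    (h : ∀ l, ‖listProd A l‖ ≤ C * c ^ l.length) : jsr A ≤ c := by
  -- A positive constant is needed for `C ^ (1 / n) → 1`.
  set D := max C 1
  have hD : 0 < D := lt_max_of_lt_right one_pos
  have hlim : Tendsto (fun n : ℕ => D ^ (1 / (n : ℝ)) * c) atTop (𝓝 c) := by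
    have h1 : Tendsto (fun n : ℕ => D ^ (1 / (n : ℝ))) atTop (𝓝 (D ^ (0 : ℝ))) :=
      tendsto_const_nhds.rpow tendsto_one_div_atTop_nhds_zero_nat (Or.inl hD.ne')
    simpa using h1.mul_const c
  refine le_of_tendsto_of_tendsto (tendsto_growth A) hlim ?_
  filter_upwards [eventually_ge_atTop 1] with n hn
  refine Real.iSup_le (fun w => ?_) (by positivity)
  have hw : ‖wordProd A w‖ ≤ D * c ^ n := by
    rw [wordProd_eq_listProd]
    refine (h _).trans ?_
    rw [List.length_reverse, List.length_ofFn]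
    gcongr
    exact le_max_left _ _
  calc ‖wordProd A w‖ ^ (1 / (n : ℝ)) ≤ (D * c ^ n) ^ (1 / (n : ℝ)) := by gcongr
    _ = _ := by
      rw [Real.mul_rpow hD.le (by positivity), one_div, Real.pow_rpow_inv_natCast hc (by omega)]

theorem exists_norm_listProd_le (A : Fin r → Matrix (Fin d) (Fin d) 𝕜) {s : ℝ} (hs : jsr A < s) :
    ∃ C, ∀ l, ‖listProd A l‖ ≤ C * s ^ l.length := by
  have hs0 : 0 < s := (jsr_nonneg A).trans_lt hs
  obtain ⟨N, hN⟩ := eventually_atTop.1 ((tendsto_growth A).eventually_lt_const hs)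
  set R := ‖A‖ / s
  have hR0 : 0 ≤ R := by positivity
  set D := ‖(1 : Matrix (Fin d) (Fin d) 𝕜)‖ * max 1 R ^ N
  refine ⟨max 1 D, fun l => ?_⟩
  rcases le_or_gt (max N 1) l.length with hl | hl
  · calc ‖listProd A l‖ ≤ growth A l.length ^ l.length :=
          norm_listProd_le_growth_pow A ((le_max_right _ _).trans hl)
      _ ≤ s ^ l.length := by
          have := growth_nonneg A l.length
          have := (hN l.length ((le_max_left _ _).trans hl)).le
          gcongr
      _ ≤ _ := le_mul_of_one_le_left (by positivity) (le_max_left _ _)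
  · have hlN : l.length ≤ N := by
      rcases lt_max_iff.1 hl with h | h <;> omega
    calc ‖listProd A l‖ ≤ ‖(1 : Matrix (Fin d) (Fin d) 𝕜)‖ * ‖A‖ ^ l.length :=
          norm_listProd_le A (norm_le_pi_norm A) l
      _ = ‖(1 : Matrix (Fin d) (Fin d) 𝕜)‖ * R ^ l.length * s ^ l.length := by
          rw [mul_assoc, ← mul_pow, div_mul_cancel₀ _ hs0.ne']
      _ ≤ ‖(1 : Matrix (Fin d) (Fin d) 𝕜)‖ * max 1 R ^ N * s ^ l.length := by
          gcongr ‖(1 : Matrix (Fin d) (Fin d) 𝕜)‖ * ?_ * _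
          calc R ^ l.length ≤ max 1 R ^ l.length := by gcongr; exact le_max_right _ _
            _ ≤ max 1 R ^ N := pow_le_pow_right₀ (le_max_left _ _) hlN
      _ ≤ _ := by
          gcongr
          exact le_max_right _ _

theorem jsr_le_norm (A : Fin r → Matrix (Fin d) (Fin d) 𝕜) : jsr A ≤ ‖A‖ :=
  jsr_le_of_norm_le A (norm_nonneg A) (norm_listProd_le A (norm_le_pi_norm A))

theorem norm_eigenvalue_le_jsr (A : Fin r → Matrix (Fin d) (Fin d) 𝕜) (i : Fin r) {a : 𝕜}
    {v : Fin d → 𝕜} (hv : v ≠ 0) (h : (A i).mulVec v = a • v) : ‖a‖ ≤ jsr A := by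
  refine ge_of_tendsto (tendsto_growth A) ?_
  filter_upwards [eventually_ge_atTop 1] with n hn
  have hpow : ∀ k, (A i ^ k).mulVec v = a ^ k • v := by
    intro k
    induction k with
    | zero => simp
    | succ k ih =>
      rw [pow_succ', ← Matrix.mulVec_mulVec, ih, Matrix.mulVec_smul, h, smul_smul, pow_succ]
  have hv' : 0 < ‖WithLp.toLp 2 v‖ := by simpa using hv
  have hle : ‖a‖ ^ n ≤ ‖A i ^ n‖ := by
    have h1 := (Matrix.toEuclideanCLM (n := Fin d) (𝕜 := 𝕜) (A i ^ n)).le_opNorm (WithLp.toLp 2 v)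
    rw [Matrix.toEuclideanCLM_toLp, hpow, WithLp.toLp_smul, norm_smul, norm_pow] at h1
    exact le_of_mul_le_mul_right h1 hv'
  have hl : listProd A (List.replicate n i) = A i ^ n := by simp [listProd]
  have h2 := norm_listProd_le_growth_pow A (l := List.replicate n i) (by simpa using hn)
  rw [hl, List.length_replicate] at h2
  exact le_of_pow_le_pow_left₀ (by omega) (growth_nonneg A n) (hle.trans h2)

end Words

/-! ### Uniform irreducibility and lower semicontinuity of the joint spectral radius -/

section Irreducible

variable {𝕜 : Type*} [RCLike 𝕜] {r d : ℕ}

open scoped InnerProductSpace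

/-- For all vectors `u` and `v`, some product of at most `N` matrices of the tuple maps `u` to a vector
whose component along `v` is at least `δ * ‖u‖` in modulus. The constants `N` and `δ` make this form of
irreducibility stable under perturbation. -/
def UniformlyTransitive (A : Fin r → Matrix (Fin d) (Fin d) 𝕜) (N : ℕ) (δ : ℝ) : Prop :=
  ∀ u v : EuclideanSpace 𝕜 (Fin d), ∃ l : List (Fin r), l.length ≤ N ∧
    δ * (‖u‖ * ‖v‖) ≤ ‖⟪v, Matrix.toEuclideanCLM (n := Fin d) (𝕜 := 𝕜) (listProd A l) u⟫_𝕜‖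

theorem continuous_toEuclideanCLM :
    Continuous (Matrix.toEuclideanCLM (n := Fin d) (𝕜 := 𝕜)) :=
  (AddMonoidHomClass.isometry_of_norm (Matrix.toEuclideanCLM (n := Fin d) (𝕜 := 𝕜))
    fun _ => rfl).continuous

theorem IsIrreducibleTuple.exists_inner_ne_zero {A : Fin r → Matrix (Fin d) (Fin d) 𝕜}
    (hA : IsIrreducibleTuple A) {u v : EuclideanSpace 𝕜 (Fin d)} (hu : u ≠ 0) (hv : v ≠ 0) :
    ∃ l, ⟪v, Matrix.toEuclideanCLM (n := Fin d) (𝕜 := 𝕜) (listProd A l) u⟫_𝕜 ≠ 0 := by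
  by_contra! h
  -- The span of the orbit of `u` is an invariant subspace orthogonal to `v`.
  set V : Submodule 𝕜 (Fin d → 𝕜) :=
    Submodule.span 𝕜 (Set.range fun l => (listProd A l).mulVec u.ofLp)
  have hinv : ∀ i, ∀ x ∈ V, (A i).mulVec x ∈ V := by
    intro i x hx
    induction hx using Submodule.span_induction with
    | mem x hx =>
      obtain ⟨l, rfl⟩ := hx
      refine Submodule.subset_span ⟨i :: l, ?_⟩
      simp [Matrix.mulVec_mulVec]
    | zero => simp
    | add x y _ _ hx hy => rw [Matrix.mulVec_add]; exact V.add_mem hx hy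
    | smul c x _ hx => rw [Matrix.mulVec_smul]; exact V.smul_mem c hx
  have horth : ∀ x ∈ V, ⟪v, WithLp.toLp 2 x⟫_𝕜 = 0 := by
    intro x hx
    induction hx using Submodule.span_induction with
    | mem x hx =>
      obtain ⟨l, rfl⟩ := hx
      exact h l
    | zero => simp
    | add x y _ _ hx hy => rw [WithLp.toLp_add, inner_add_right, hx, hy, add_zero]
    | smul c x _ hx => rw [WithLp.toLp_smul, inner_smul_right, hx, mul_zero]
  rcases hA V hinv with hV | hV
  · have hmem : u.ofLp ∈ V := Submodule.subset_span ⟨[], by simp⟩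
    rw [hV, Submodule.mem_bot] at hmem
    exact hu (by simpa using hmem)
  · exact hv (inner_self_eq_zero.1 (horth v.ofLp (hV ▸ Submodule.mem_top)))

/-- Irreducibility persists near `A` with uniform constants, by compactness of the unit sphere. -/
theorem IsIrreducibleTuple.eventually_uniformlyTransitive
    {A : Fin r → Matrix (Fin d) (Fin d) 𝕜} (hA : IsIrreducibleTuple A) :
    ∃ N : ℕ, ∃ δ > 0, ∀ᶠ A' in 𝓝 A, UniformlyTransitive A' N δ := by
  set S := Metric.sphere (0 : EuclideanSpace 𝕜 (Fin d)) 1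
  have hcomp : IsCompact (S ×ˢ S) := (isCompact_sphere _ _).prod (isCompact_sphere _ _)
  have key : ∃ N : ℕ, ∃ δ > 0, ∀ᶠ A' in 𝓝 A, ∀ p ∈ S ×ˢ S, ∃ l : List (Fin r), l.length ≤ N ∧
      δ ≤ ‖⟪p.2, Matrix.toEuclideanCLM (n := Fin d) (𝕜 := 𝕜) (listProd A' l) p.1⟫_𝕜‖ := by
    refine hcomp.induction_on (p := fun T => ∃ N : ℕ, ∃ δ > 0, ∀ᶠ A' in 𝓝 A, ∀ p ∈ T,
      ∃ l : List (Fin r), l.length ≤ N ∧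
      δ ≤ ‖⟪p.2, Matrix.toEuclideanCLM (n := Fin d) (𝕜 := 𝕜) (listProd A' l) p.1⟫_𝕜‖)
      ⟨0, 1, one_pos, by simp⟩ ?_ ?_ ?_
    · rintro T T' hTT' ⟨N, δ, hδ, h⟩
      exact ⟨N, δ, hδ, h.mono fun A' h p hp => h p (hTT' hp)⟩
    · rintro T T' ⟨N, δ, hδ, h⟩ ⟨N', δ', hδ', h'⟩
      refine ⟨max N N', min δ δ', lt_min hδ hδ', ?_⟩
      filter_upwards [h, h'] with A' h h' p hp
      rcases hp with hp | hp
      · obtain ⟨l, hl, hle⟩ := h p hp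
        exact ⟨l, hl.trans (le_max_left _ _), (min_le_left _ _).trans hle⟩
      · obtain ⟨l, hl, hle⟩ := h' p hp
        exact ⟨l, hl.trans (le_max_right _ _), (min_le_right _ _).trans hle⟩
    · rintro ⟨u, v⟩ ⟨hu, hv⟩
      have hu0 : u ≠ 0 := ne_zero_of_mem_unit_sphere ⟨u, hu⟩
      have hv0 : v ≠ 0 := ne_zero_of_mem_unit_sphere ⟨v, hv⟩
      obtain ⟨l, hl⟩ := hA.exists_inner_ne_zero hu0 hv0
      have hpos := norm_pos_iff.2 hl
      have hcont : Continuous fun q : (Fin r → Matrix (Fin d) (Fin d) 𝕜) ×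
          (EuclideanSpace 𝕜 (Fin d) × EuclideanSpace 𝕜 (Fin d)) =>
          ‖⟪q.2.2, Matrix.toEuclideanCLM (n := Fin d) (𝕜 := 𝕜) (listProd q.1 l) q.2.1⟫_𝕜‖ := by
        have h1 : Continuous fun q : (Fin r → Matrix (Fin d) (Fin d) 𝕜) ×
            (EuclideanSpace 𝕜 (Fin d) × EuclideanSpace 𝕜 (Fin d)) =>
            Matrix.toEuclideanCLM (n := Fin d) (𝕜 := 𝕜) (listProd q.1 l) :=
          continuous_toEuclideanCLM.comp ((continuous_listProd l).comp continuous_fst)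
        have h2 := h1.clm_apply (continuous_snd.fst)
        exact (continuous_snd.snd.inner h2).norm
      have hev := (hcont.tendsto (A, (u, v))).eventually (lt_mem_nhds (half_lt_self hpos))
      rw [nhds_prod_eq, eventually_prod_iff] at hev
      obtain ⟨P, hP, Q, hQ, hPQ⟩ := hev
      refine ⟨{q | Q q}, mem_nhdsWithin_of_mem_nhds hQ, l.length, _, half_pos hpos, ?_⟩
      filter_upwards [hP] with A' hA' p hp
      exact ⟨l, le_rfl, (hPQ hA' hp).le⟩
  obtain ⟨N, δ, hδ, h⟩ := key
  refine ⟨N, δ, hδ, h.mono fun A' h u v => ?_⟩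
  rcases eq_or_ne u 0 with rfl | hu
  · exact ⟨[], by simp, by simp⟩
  rcases eq_or_ne v 0 with rfl | hv
  · exact ⟨[], by simp, by simp⟩
  have hu' := norm_pos_iff.2 hu
  have hv' := norm_pos_iff.2 hv
  obtain ⟨l, hl, hle⟩ := h (((‖u‖⁻¹ : ℝ) : 𝕜) • u, ((‖v‖⁻¹ : ℝ) : 𝕜) • v)
    ⟨by simp [S, norm_smul, hu'.ne'], by simp [S, norm_smul, hv'.ne']⟩
  refine ⟨l, hl, ?_⟩
  simp only [map_smul, inner_smul_left, inner_smul_right, norm_mul, RCLike.norm_conj,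
    RCLike.norm_ofReal, abs_inv, abs_norm] at hle
  calc δ * (‖u‖ * ‖v‖) ≤ _ * (‖u‖ * ‖v‖) := mul_le_mul_of_nonneg_right hle (by positivity)
    _ = _ := by field_simp

theorem UniformlyTransitive.isIrreducibleTuple {A : Fin r → Matrix (Fin d) (Fin d) 𝕜} {N : ℕ}
    {δ : ℝ} (hδ : 0 < δ) (h : UniformlyTransitive A N δ) : IsIrreducibleTuple A := by
  intro V hV
  by_contra! hne
  have hinv : ∀ l, ∀ x ∈ V, (listProd A l).mulVec x ∈ V := by
    intro l x hx
    induction l with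
    | nil => simpa using hx
    | cons i l ih =>
      rw [listProd_cons, ← Matrix.mulVec_mulVec]
      exact hV i _ ih
  obtain ⟨u, huV, hu⟩ := V.ne_bot_iff.1 hne.1
  set e := (WithLp.linearEquiv 2 𝕜 (Fin d → 𝕜)).symm
  have hW : V.map e.toLinearMap ≠ ⊤ := by
    intro htop
    apply hne.2
    rw [eq_top_iff]
    intro x _
    obtain ⟨y, hy, hyx⟩ := (htop ▸ Submodule.mem_top : e x ∈ V.map e.toLinearMap)
    rwa [← e.injective hyx]
  obtain ⟨v, hvW, hv⟩ := (Submodule.ne_bot_iff _).1 (mt Submodule.orthogonal_eq_bot_iff.1 hW)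
  obtain ⟨l, -, hle⟩ := h (WithLp.toLp 2 u) v
  have hmem : WithLp.toLp 2 ((listProd A l).mulVec u) ∈ V.map e.toLinearMap :=
    ⟨_, hinv l u huV, rfl⟩
  rw [Matrix.toEuclideanCLM_toLp, (Submodule.mem_orthogonal' _ _).1 hvW _ hmem, norm_zero] at hle
  have h1 : 0 < ‖WithLp.toLp 2 u‖ := by simpa using hu
  have h2 := norm_pos_iff.2 hv
  have : 0 < δ * (‖WithLp.toLp 2 u‖ * ‖v‖) := by positivity
  linarith

theorem isOpen_irreducibleTuples : IsOpen (irreducibleTuples 𝕜 r d) := by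
  refine isOpen_iff_mem_nhds.2 fun A hA => ?_
  obtain ⟨N, δ, hδ, h⟩ := IsIrreducibleTuple.eventually_uniformlyTransitive hA
  exact h.mono fun A' h => h.isIrreducibleTuple hδ

/-- Two matrices can be joined by a short word without losing more than a constant factor of the
product of their norms. -/
theorem UniformlyTransitive.exists_le_norm_mul {A : Fin r → Matrix (Fin d) (Fin d) 𝕜} {N : ℕ}
    {δ : ℝ} (hδ : 0 < δ) (h : UniformlyTransitive A N δ) (P Q : Matrix (Fin d) (Fin d) 𝕜) :
    ∃ l : List (Fin r), l.length ≤ N ∧ δ / 2 * (‖P‖ * ‖Q‖) ≤ ‖P * listProd A l * Q‖ := by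
  by_contra! hlt
  set T := Matrix.toEuclideanCLM (n := Fin d) (𝕜 := 𝕜)
  have hc : 0 < δ / 2 * (‖P‖ * ‖Q‖) :=
    (norm_nonneg _).trans_lt (hlt [] (Nat.zero_le _))
  set c := δ / 2 * (‖P‖ * ‖Q‖) with hcdef
  have h1 : ∀ x y, δ * (‖T Q x‖ * ‖ContinuousLinearMap.adjoint (T P) y‖) ≤ c * (‖x‖ * ‖y‖) := by
    intro x y
    obtain ⟨l, hl, hle⟩ := h (T Q x) (ContinuousLinearMap.adjoint (T P) y)
    rw [ContinuousLinearMap.adjoint_inner_left] at hle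
    refine hle.trans ?_
    have hmul : T P (T (listProd A l) (T Q x)) = T (P * listProd A l * Q) x := by
      rw [map_mul, map_mul]
      rfl
    rw [hmul]
    calc _ ≤ ‖y‖ * ‖T (P * listProd A l * Q) x‖ := norm_inner_le_norm _ _
      _ ≤ ‖y‖ * (‖P * listProd A l * Q‖ * ‖x‖) := by
          gcongr
          exact (T (P * listProd A l * Q)).le_opNorm x
      _ ≤ ‖y‖ * (c * ‖x‖) := by
          gcongr
          exact (hlt l hl).le
      _ = _ := by ring
  have hP : 0 ≤ ‖P‖ := norm_nonneg P
  have h2 : ∀ x, δ * (‖P‖ * ‖T Q x‖) ≤ c * ‖x‖ := by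
    intro x
    rcases eq_or_ne (T Q x) 0 with h0 | h0
    · rw [h0]; simp; positivity
    have hx := norm_pos_iff.2 h0
    have : ‖ContinuousLinearMap.adjoint (T P)‖ ≤ c * ‖x‖ / (δ * ‖T Q x‖) := by
      refine ContinuousLinearMap.opNorm_le_bound _ (by positivity) fun y => ?_
      rw [div_mul_eq_mul_div, le_div_iff₀ (by positivity)]
      linarith [h1 x y]
    rw [LinearIsometryEquiv.norm_map, le_div_iff₀ (by positivity)] at this
    have hPn : ‖T P‖ = ‖P‖ := rfl
    rw [hPn] at this
    linarith
  have hPpos : 0 < ‖P‖ := hP.lt_of_ne fun h0 => by rw [hcdef, ← h0] at hc; simp at hc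
  have h3 : ‖T Q‖ ≤ c / (δ * ‖P‖) := by
    refine ContinuousLinearMap.opNorm_le_bound _ (by positivity) fun x => ?_
    rw [div_mul_eq_mul_div, le_div_iff₀ (by positivity)]
    linarith [h2 x]
  rw [le_div_iff₀ (by positivity)] at h3
  have hQn : ‖T Q‖ = ‖Q‖ := rfl
  rw [hQn] at h3
  linarith

/-- Products of a uniformly transitive tuple grow no faster than the powers of the joint spectral
radius. Repeating a word `l`, with connecting words in between, yields arbitrarily long products of
norm about `(δ ‖A_l‖ / 2) ^ k`, which must not exceed the growth rate. -/
theorem UniformlyTransitive.norm_listProd_le {A : Fin r → Matrix (Fin d) (Fin d) 𝕜} {N : ℕ}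
    {δ : ℝ} (hδ : 0 < δ) (h : UniformlyTransitive A N δ) (l : List (Fin r)) :
    ‖listProd A l‖ ≤ max 1 (jsr A) ^ N / (δ / 2) * jsr A ^ l.length := by
  set m := l.length
  have hchain : ∀ k : ℕ, ∃ l' : List (Fin r), ∃ j ≤ k * N, l'.length = m * (k + 1) + j ∧
      (δ / 2 * ‖listProd A l‖) ^ k * ‖listProd A l‖ ≤ ‖listProd A l'‖ := by
    intro k
    induction k with
    | zero => exact ⟨l, 0, by simp, by simp [m], by simp⟩
    | succ k ih =>
      obtain ⟨l', j, hj, hlen, hle⟩ := ih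
      obtain ⟨q, hq, hqle⟩ := h.exists_le_norm_mul hδ (listProd A l) (listProd A l')
      refine ⟨l ++ q ++ l', q.length + j, by linarith, ?_, ?_⟩
      · simp only [List.length_append, hlen]
        ring
      · rw [listProd_append, listProd_append]
        refine le_trans ?_ hqle
        rw [pow_succ', mul_assoc, mul_assoc]
        gcongr
  have hgt : ∀ s > jsr A, δ / 2 * ‖listProd A l‖ ≤ s ^ m * max 1 s ^ N := by
    intro s hs
    have hs0 : 0 < s := (jsr_nonneg A).trans_lt hs
    obtain ⟨C, hC⟩ := exists_norm_listProd_le A hs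
    set a := δ / 2 * ‖listProd A l‖ with ha
    set b := s ^ m * max 1 s ^ N with hb
    have hb0 : 0 < b := by positivity
    by_contra! hab
    have hx : 0 < ‖listProd A l‖ := by
      by_contra! h0
      have : a ≤ 0 := mul_nonpos_of_nonneg_of_nonpos (by positivity) h0
      linarith
    have hC0 : 0 ≤ C := by
      have := (norm_nonneg _).trans (hC [])
      simpa using this
    have hle : ∀ k : ℕ, (a / b) ^ k ≤ C * s ^ m / ‖listProd A l‖ := by
      intro k
      obtain ⟨l', j, hj, hlen, hle⟩ := hchain k
      rw [div_pow, div_le_div_iff₀ (by positivity) hx]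
      refine hle.trans ((hC l').trans ?_)
      have hsj : s ^ j ≤ max 1 s ^ (k * N) :=
        (pow_le_pow_left₀ hs0.le (le_max_right _ _) j).trans
          (pow_le_pow_right₀ (le_max_left _ _) hj)
      calc C * s ^ l'.length = C * s ^ m * (s ^ m) ^ k * s ^ j := by
            rw [hlen, pow_add, pow_mul, pow_succ]; ring
        _ ≤ C * s ^ m * (s ^ m) ^ k * max 1 s ^ (k * N) := by gcongr
        _ = C * s ^ m * b ^ k := by
            rw [hb, mul_pow, ← pow_mul (max 1 s), mul_comm N k]; ring
    have hdiv : 1 < a / b := (one_lt_div hb0).2 hab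
    obtain ⟨k, hk⟩ := ((tendsto_pow_atTop_atTop_of_one_lt hdiv).eventually_gt_atTop
      (C * s ^ m / ‖listProd A l‖)).exists
    exact absurd (hle k) (not_le.2 hk)
  have hcont : Continuous fun s : ℝ => s ^ m * max 1 s ^ N := by fun_prop
  have hlim : δ / 2 * ‖listProd A l‖ ≤ jsr A ^ m * max 1 (jsr A) ^ N := by
    refine ge_of_tendsto ((hcont.tendsto (jsr A)).mono_left nhdsWithin_le_nhds
      : Tendsto _ (𝓝[>] (jsr A)) _) ?_
    filter_upwards [self_mem_nhdsWithin] with s hs using hgt s hs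
  rw [div_mul_eq_mul_div, le_div_iff₀ (by positivity)]
  linarith

/-- Near an irreducible tuple the products are bounded by powers of the joint spectral radius, with
a uniform constant. -/
theorem IsIrreducibleTuple.eventually_norm_listProd_le
    {A : Fin r → Matrix (Fin d) (Fin d) 𝕜} (hA : IsIrreducibleTuple A) :
    ∃ K, ∀ᶠ A' in 𝓝 A, ∀ l, ‖listProd A' l‖ ≤ K * jsr A' ^ l.length := by
  obtain ⟨N, δ, hδ, h⟩ := hA.eventually_uniformlyTransitive
  have hR : ∀ᶠ A' in 𝓝 A, ‖A'‖ < ‖A‖ + 1 :=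
    (continuous_norm.tendsto A).eventually (gt_mem_nhds (lt_add_one _))
  refine ⟨max 1 (‖A‖ + 1) ^ N / (δ / 2), ?_⟩
  filter_upwards [h, hR] with A' h hR l
  refine (h.norm_listProd_le hδ l).trans ?_
  have h0 := jsr_nonneg A'
  have h1 := (jsr_le_norm A').trans hR.le
  gcongr

theorem IsIrreducibleTuple.eventually_lt_jsr {A : Fin r → Matrix (Fin d) (Fin d) 𝕜}
    (hA : IsIrreducibleTuple A) {c : ℝ} (hc0 : 0 ≤ c) (hc : c < jsr A) :
    ∀ᶠ A' in 𝓝 A, c < jsr A' := by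
  obtain ⟨K, hK⟩ := hA.eventually_norm_listProd_le
  by_contra hnot
  have hfreq : ∃ᶠ A' in 𝓝 A, ∀ l, ‖listProd A' l‖ ≤ max K 0 * c ^ l.length := by
    refine ((not_eventually.1 hnot).and_eventually hK).mono ?_
    rintro A' ⟨h1, h2⟩ l
    refine (h2 l).trans ?_
    have h0 := jsr_nonneg A'
    exact mul_le_mul (le_max_left _ _) (pow_le_pow_left₀ h0 (not_lt.1 h1) _) (pow_nonneg h0 _)
      (le_max_right _ _)
  have hclosed : ∀ l, IsClosed {A' : Fin r → Matrix (Fin d) (Fin d) 𝕜 |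
      ‖listProd A' l‖ ≤ max K 0 * c ^ l.length} := fun l =>
    isClosed_le (continuous_listProd l).norm continuous_const
  have hmem : ∀ l, ‖listProd A l‖ ≤ max K 0 * c ^ l.length := by
    intro l
    have h1 := mem_closure_iff_frequently.2 (hfreq.mono fun A' h => h l)
    exact (hclosed l).closure_subset h1
  exact absurd (jsr_le_of_norm_le A hc0 hmem) (not_le.2 hc)

end Irreducible

/-! ### The second compound of a matrix -/

section Compound

variable {𝕜 : Type*} [RCLike 𝕜] {r d : ℕ}

/-- The second compound of a matrix, indexed by all pairs `(i, j)` rather than by those with `i < j`.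
Each unordered pair is thus counted twice, and the factor `2⁻¹` restores multiplicativity. -/
def compound (M : Matrix (Fin d) (Fin d) 𝕜) : Matrix (Fin d × Fin d) (Fin d × Fin d) 𝕜 :=
  Matrix.of fun p q => 2⁻¹ * (M p.1 q.1 * M p.2 q.2 - M p.1 q.2 * M p.2 q.1)

theorem compound_mul (M M' : Matrix (Fin d) (Fin d) 𝕜) :
    compound (M * M') = compound M * compound M' := by
  ext ⟨i, j⟩ ⟨p, q⟩
  have hsum : ∀ a b c e : Fin d → 𝕜,
      (∑ k, a k * b k) * ∑ k, c k * e k = ∑ k, ∑ l, a k * b k * (c l * e l) :=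
    fun a b c e => Finset.sum_mul_sum _ _ _ _
  have hswap : ∀ a b c e : Fin d → 𝕜,
      (∑ k, a k * b k) * ∑ k, c k * e k = ∑ k, ∑ l, a l * b l * (c k * e k) := fun a b c e => by
    rw [hsum, Finset.sum_comm]
  -- Each of the two products of sums is written once with either order of summation.
  have h1 : (2⁻¹ : 𝕜) * ((M * M') i p * (M * M') j q - (M * M') i q * (M * M') j p) =
      4⁻¹ * ((∑ k, ∑ l, M i k * M' k p * (M j l * M' l q)) +
        (∑ k, ∑ l, M i l * M' l p * (M j k * M' k q)) -
        (∑ k, ∑ l, M i k * M' k q * (M j l * M' l p)) -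
        (∑ k, ∑ l, M i l * M' l q * (M j k * M' k p))) := by
    simp only [Matrix.mul_apply]
    rw [← hsum, ← hsum, ← hswap, ← hswap]
    ring
  simp only [compound, Matrix.of_apply]
  rw [h1, Matrix.mul_apply, Fintype.sum_prod_type]
  simp only [Matrix.of_apply, ← Finset.sum_add_distrib, ← Finset.sum_sub_distrib, Finset.mul_sum]
  refine Finset.sum_congr rfl fun k _ => Finset.sum_congr rfl fun l _ => ?_
  ring

theorem compound_smul (c : ℝ) (M : Matrix (Fin d) (Fin d) 𝕜) :
    compound (c • M) = c ^ 2 • compound M := by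
  ext p q
  simp only [compound, Matrix.of_apply, Matrix.smul_apply, RCLike.real_smul_eq_coe_mul]
  push_cast
  ring

theorem continuous_compound :
    Continuous (compound : Matrix (Fin d) (Fin d) 𝕜 → _) := by
  refine continuous_matrix fun p q => ?_
  simp only [compound, Matrix.of_apply]
  have h : ∀ i j, Continuous fun M : Matrix (Fin d) (Fin d) 𝕜 => M i j :=
    fun i j => continuous_id.matrix_elem i j
  exact continuous_const.mul (((h _ _).mul (h _ _)).sub ((h _ _).mul (h _ _)))

theorem compound_eq_zero_iff {M : Matrix (Fin d) (Fin d) 𝕜} (hM : M ≠ 0) :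
    compound M = 0 ↔ M.rank = 1 := by
  constructor
  · intro h
    obtain ⟨i, j, hij⟩ : ∃ i j, M i j ≠ 0 := by
      by_contra! h0
      exact hM (Matrix.ext h0)
    have hM' : M = Matrix.vecMulVec (fun k => M k j) (fun l => M i l / M i j) := by
      ext k l
      have h1 := congrFun (congrFun h (i, k)) (j, l)
      simp only [compound, Matrix.of_apply, Matrix.zero_apply, mul_eq_zero, inv_eq_zero,
        OfNat.ofNat_ne_zero, false_or] at h1
      rw [Matrix.vecMulVec_apply]
      field_simp
      linear_combination h1
    apply le_antisymm
    · rw [hM']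
      exact Matrix.rank_vecMulVec_le _ _
    · rw [Nat.one_le_iff_ne_zero]
      intro h0
      rw [Matrix.rank, Submodule.finrank_eq_zero, LinearMap.range_eq_bot] at h0
      refine hM (Matrix.mulVec_injective (funext fun x => ?_))
      rw [Matrix.zero_mulVec]
      exact LinearMap.congr_fun h0 x
  · intro h
    obtain ⟨v, -, hv⟩ := finrank_eq_one_iff'.1 h
    have hcol : ∀ l, ∃ c : 𝕜, ∀ k, M k l = c * v.1 k := by
      intro l
      obtain ⟨c, hc⟩ := hv ⟨M.mulVec (Pi.single l 1), ⟨Pi.single l 1, rfl⟩⟩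
      refine ⟨c, fun k => ?_⟩
      have h1 := congrFun (congrArg Subtype.val hc) k
      simpa using h1.symm
    choose c hc using hcol
    ext p q
    simp only [compound, Matrix.of_apply, hc, Matrix.zero_apply]
    ring

end Compound

/-! ### The rank one property in terms of compounds -/

section Criterion

variable {𝕜 : Type*} [RCLike 𝕜] {r d : ℕ}

theorem relativelyProductBounded_of_norm_le {A : Fin r → Matrix (Fin d) (Fin d) 𝕜} {K : ℝ}
    (hpos : 0 < jsr A) (hK : ∀ l, ‖listProd A l‖ ≤ K * jsr A ^ l.length) :
    RelativelyProductBounded A := by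
  refine ⟨hpos, isBounded_iff_forall_norm_le.2 ⟨K, fun B hB => ?_⟩⟩
  obtain ⟨n, -, hB⟩ := Set.mem_iUnion₂.1 hB
  rw [products_eq] at hB
  obtain ⟨l, -, rfl⟩ := hB
  rw [listProd_smul, norm_real_smul, abs_of_nonneg (by positivity), inv_pow,
    inv_mul_le_iff₀ (by positivity), mul_comm]
  exact hK l

theorem norm_compound_scaled (A : Fin r → Matrix (Fin d) (Fin d) 𝕜) (l : List (Fin r)) (n : ℕ) :
    ‖compound ((jsr A ^ n)⁻¹ • listProd A l)‖ = ‖compound (listProd A l)‖ / jsr A ^ (2 * n) := by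
  have := jsr_nonneg A
  rw [compound_smul, norm_real_smul, abs_of_nonneg (by positivity), inv_pow, ← pow_mul, mul_comm n 2,
    div_eq_inv_mul]

/-- If the compounds of the products of one fixed length are small, then those of all long products
decay exponentially, and in the limit only matrices of rank at most one survive. -/
theorem rankOneProperty_of_norm_compound_lt {A : Fin r → Matrix (Fin d) (Fin d) 𝕜} {K : ℝ}
    (hpos : 0 < jsr A) (hK : ∀ l, ‖listProd A l‖ ≤ K * jsr A ^ l.length) {n : ℕ} (hn : 1 ≤ n)
    (h : ∀ l : List (Fin r), l.length = n → ‖compound (listProd A l)‖ < jsr A ^ (2 * n)) :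
    RankOneProperty A := by
  refine ⟨relativelyProductBounded_of_norm_le hpos hK, fun B hB hB0 => ?_⟩
  rw [← compound_eq_zero_iff hB0]
  -- The products of length `n` contract by a common factor `q < 1`, as there are finitely many.
  obtain ⟨q, hq0, hq1, hq⟩ : ∃ q : ℝ, 0 ≤ q ∧ q < 1 ∧ ∀ l : List (Fin r), l.length = n →
      ‖compound ((jsr A ^ l.length)⁻¹ • listProd A l)‖ ≤ q := by
    have hfin : {l : List (Fin r) | l.length = n}.Finite := List.finite_length_eq _ _
    have hbdd : ∀ᶠ q in 𝓝[<] (1 : ℝ), ∀ l ∈ {l : List (Fin r) | l.length = n},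
        ‖compound ((jsr A ^ l.length)⁻¹ • listProd A l)‖ ≤ q := by
      rw [hfin.eventually_all]
      intro l hl
      have hlt : ‖compound ((jsr A ^ l.length)⁻¹ • listProd A l)‖ < 1 := by
        rw [norm_compound_scaled, div_lt_one (by positivity), hl]
        exact h l hl
      filter_upwards [mem_nhdsWithin_of_mem_nhds (lt_mem_nhds hlt)] with q hq using hq.le
    have h0 : ∀ᶠ q in 𝓝[<] (1 : ℝ), 0 ≤ q :=
      ((lt_mem_nhds one_pos).filter_mono nhdsWithin_le_nhds).mono fun q hq => hq.le
    obtain ⟨q, ⟨h1, h2⟩, h3⟩ := ((hbdd.and h0).and self_mem_nhdsWithin).exists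
    exact ⟨q, h2, h3, h1⟩
  -- The remaining, shorter factor contributes a bounded amount.
  obtain ⟨C, hC⟩ : ∃ C : ℝ, ∀ l : List (Fin r), l.length < n →
      ‖compound ((jsr A ^ l.length)⁻¹ • listProd A l)‖ ≤ C := by
    have hfin : {l : List (Fin r) | l.length < n}.Finite := List.finite_length_lt _ _
    obtain ⟨C, hC⟩ := (hfin.image fun l =>
      ‖compound ((jsr A ^ l.length)⁻¹ • listProd A l)‖).bddAbove
    exact ⟨C, fun l hl => hC ⟨l, hl, rfl⟩⟩
  have hdecay : ∀ (k : ℕ) (l : List (Fin r)), k * n ≤ l.length → l.length < (k + 1) * n →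
      ‖compound ((jsr A ^ l.length)⁻¹ • listProd A l)‖ ≤ C * q ^ k := by
    intro k
    induction k with
    | zero =>
      intro l _ hl
      simpa using hC l (by simpa using hl)
    | succ k ih =>
      intro l hl hl'
      have hnl : n ≤ l.length := by nlinarith
      have htake : (l.take n).length = n := by simpa using hnl
      have hdrop : (l.drop n).length = l.length - n := by simp
      have e1 : (k + 1) * n = k * n + n := by ring
      have e2 : (k + 1 + 1) * n = (k + 1) * n + n := by ring
      have h1 := ih (l.drop n) (by omega) (by omega)
      have h2 := hq (l.take n) htake
      have hsplit : (jsr A ^ l.length)⁻¹ • listProd A l =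
          ((jsr A ^ (l.take n).length)⁻¹ • listProd A (l.take n)) *
            ((jsr A ^ (l.drop n).length)⁻¹ • listProd A (l.drop n)) := by
        rw [smul_mul_smul_comm, ← listProd_append, List.take_append_drop, ← mul_inv, ← pow_add,
          ← List.length_append, List.take_append_drop]
      rw [hsplit, compound_mul]
      calc _ ≤ _ * _ := norm_mul_le _ _
        _ ≤ q * (C * q ^ k) := mul_le_mul h2 h1 (norm_nonneg _) hq0
        _ = _ := by ring
  have hsmall : ∀ k : ℕ, ‖compound B‖ ≤ max C 0 * q ^ k := by
    intro k
    have hclosed : IsClosed {M : Matrix (Fin d) (Fin d) 𝕜 | ‖compound M‖ ≤ max C 0 * q ^ k} :=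
      isClosed_le continuous_compound.norm continuous_const
    have hm : k * n + 1 ∈ Set.Ici 1 := by simp
    refine hclosed.closure_subset_iff.2 ?_ (Set.mem_iInter₂.1 hB (k * n + 1) hm)
    intro M hM
    obtain ⟨p, hp, B', hB', rfl⟩ := Set.mem_iUnion₂.1 hM
    rw [products_eq] at hB'
    obtain ⟨l, rfl, rfl⟩ := hB'
    have hp : k * n + 1 ≤ l.length := hp
    have hk : k ≤ l.length / n := (Nat.le_div_iff_mul_le (by omega)).2 (by omega)
    refine (hdecay (l.length / n) l (Nat.div_mul_le_self _ _)
      (Nat.lt_mul_of_div_lt (Nat.lt_succ_self _) (by omega))).trans ?_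
    exact mul_le_mul (le_max_left _ _) (pow_le_pow_of_le_one hq0 hq1.le hk) (by positivity)
      (le_max_right _ _)
  have hlim : Tendsto (fun k : ℕ => max C 0 * q ^ k) atTop (𝓝 0) := by
    simpa using (tendsto_pow_atTop_nhds_zero_of_lt_one hq0 hq1).const_mul (max C 0)
  exact norm_le_zero_iff.1 (ge_of_tendsto' hlim hsmall)

/-- Under the rank one property the compounds are small at some length: otherwise products violating
the inequality at each length would accumulate at an element of the limit semigroup of rank above
one. -/
theorem RankOneProperty.exists_norm_compound_lt {A : Fin r → Matrix (Fin d) (Fin d) 𝕜}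
    (h : RankOneProperty A) : ∃ n, 1 ≤ n ∧ ∀ l : List (Fin r), l.length = n →
      ‖compound (listProd A l)‖ < jsr A ^ (2 * n) := by
  obtain ⟨⟨hpos, hbdd⟩, hrank⟩ := h
  by_contra! hnot
  choose! l hlen hl using hnot
  set X : ℕ → Matrix (Fin d) (Fin d) 𝕜 :=
    fun n => (jsr A ^ (n + 1))⁻¹ • listProd A (l (n + 1)) with hX
  have hmem : ∀ n, X n ∈ ⋃ n ∈ Set.Ici 1, products (fun i => (jsr A)⁻¹ • A i) n := by
    intro n
    refine Set.mem_iUnion₂.2 ⟨n + 1, by simp, ?_⟩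
    rw [products_eq]
    have hn := hlen (n + 1) (by omega)
    exact ⟨l (n + 1), hn, by rw [listProd_smul, hn, inv_pow]⟩
  have : ProperSpace (Matrix (Fin d) (Fin d) 𝕜) := FiniteDimensional.proper 𝕜 _
  obtain ⟨B, -, φ, hφ, hlim⟩ := tendsto_subseq_of_bounded hbdd hmem
  have hBS : B ∈ limitSemigroup A := by
    refine Set.mem_iInter₂.2 fun m _ => mem_closure_of_tendsto hlim ?_
    filter_upwards [eventually_ge_atTop m] with k hk
    refine Set.mem_iUnion₂.2 ⟨φ k + 1, ?_, listProd A (l (φ k + 1)), ?_, rfl⟩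
    · exact hk.trans ((hφ.id_le k).trans (Nat.le_succ _))
    · rw [products_eq]
      exact ⟨_, hlen _ (by omega), rfl⟩
  have hone : 1 ≤ ‖compound B‖ := by
    refine ge_of_tendsto' ((continuous_compound.norm.tendsto B).comp hlim) fun k => ?_
    simp only [Function.comp_apply, hX]
    rw [norm_compound_scaled, one_le_div (by positivity)]
    exact hl _ (by omega)
  have hne : compound B ≠ 0 := fun h0 => by rw [h0, norm_zero] at hone; linarith
  have hB0 : B ≠ 0 := by
    rintro rfl
    exact hne (by ext p q; simp [compound])
  exact hne ((compound_eq_zero_iff hB0).2 (hrank B hBS hB0))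

theorem IsIrreducibleTuple.eventually_rankOneProperty {A : Fin r → Matrix (Fin d) (Fin d) 𝕜}
    (hA : IsIrreducibleTuple A) (h : RankOneProperty A) : ∀ᶠ A' in 𝓝 A, RankOneProperty A' := by
  obtain ⟨n, hn, hlt⟩ := h.exists_norm_compound_lt
  have hpos : 0 < jsr A := h.1.1
  obtain ⟨K, hK⟩ := hA.eventually_norm_listProd_le
  have hfin : {l : List (Fin r) | l.length = n}.Finite := List.finite_length_eq _ _
  -- A number `c` strictly between separates the two sides of the strict inequality.
  obtain ⟨c, hc0, hc1, hc⟩ : ∃ c : ℝ, 0 < c ∧ c < jsr A ∧ ∀ l : List (Fin r), l.length = n →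
      ‖compound (listProd A l)‖ < c ^ (2 * n) := by
    have h1 : ∀ᶠ c in 𝓝[<] (jsr A), ∀ l ∈ {l : List (Fin r) | l.length = n},
        ‖compound (listProd A l)‖ < c ^ (2 * n) := by
      rw [hfin.eventually_all]
      intro l hl
      exact (((continuous_pow (2 * n)).tendsto (jsr A)).eventually
        (lt_mem_nhds (hlt l hl))).filter_mono nhdsWithin_le_nhds
    have h0 : ∀ᶠ c in 𝓝[<] (jsr A), 0 < c := mem_nhdsWithin_of_mem_nhds (lt_mem_nhds hpos)
    obtain ⟨c, ⟨h1, h2⟩, h3⟩ := ((h1.and h0).and self_mem_nhdsWithin).exists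
    exact ⟨c, h2, h3, h1⟩
  have hcomp : ∀ᶠ A' in 𝓝 A, ∀ l ∈ {l : List (Fin r) | l.length = n},
      ‖compound (listProd A' l)‖ < c ^ (2 * n) := by
    rw [hfin.eventually_all]
    intro l hl
    exact ((continuous_compound.comp (continuous_listProd l)).norm.tendsto A).eventually
      (gt_mem_nhds (hc l hl))
  filter_upwards [hK, hcomp, hA.eventually_lt_jsr hc0.le hc1] with A' hK hcomp hjsr
  refine rankOneProperty_of_norm_compound_lt (hc0.trans hjsr) hK hn fun l hl => ?_
  exact (hcomp l hl).trans_le (pow_le_pow_left₀ hc0.le hjsr.le _)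

end Criterion

/-! ### Density in dimension two -/

section Density

theorem compound_fin_two (M : Matrix (Fin 2) (Fin 2) ℂ) :
    compound M = M.det • compound (1 : Matrix (Fin 2) (Fin 2) ℂ) := by
  ext ⟨i, j⟩ ⟨p, q⟩
  fin_cases i <;> fin_cases j <;> fin_cases p <;> fin_cases q <;>
    simp [compound, Matrix.det_fin_two] <;> ring

theorem norm_det_listProd_le {r : ℕ} {A : Fin r → Matrix (Fin 2) (Fin 2) ℂ} {b : ℝ}
    (hb : ∀ i, ‖(A i).det‖ ≤ b) (l : List (Fin r)) :
    ‖(listProd A l).det‖ ≤ b ^ l.length := by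
  induction l with
  | nil => simp
  | cons i l ih =>
    have hb0 : 0 ≤ b := (norm_nonneg _).trans (hb i)
    rw [listProd_cons, Matrix.det_mul, norm_mul, List.length_cons, pow_succ']
    exact mul_le_mul (hb i) ih (norm_nonneg _) hb0

/-- In dimension two the second compound is the determinant up to a fixed matrix, and can be bounded
factor by factor. -/
theorem IsIrreducibleTuple.rankOneProperty_of_norm_det_lt {r : ℕ}
    {A : Fin r → Matrix (Fin 2) (Fin 2) ℂ} (hA : IsIrreducibleTuple A) (hpos : 0 < jsr A)
    (h : ∀ i, ‖(A i).det‖ < jsr A ^ 2) : RankOneProperty A := by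
  obtain ⟨K, hK⟩ := hA.eventually_norm_listProd_le
  obtain ⟨b, hb0, hb1, hb⟩ : ∃ b : ℝ, 0 ≤ b ∧ b < jsr A ^ 2 ∧ ∀ i, ‖(A i).det‖ ≤ b := by
    have h1 : ∀ᶠ b in 𝓝[<] (jsr A ^ 2), ∀ i, ‖(A i).det‖ ≤ b := by
      rw [eventually_all]
      intro i
      exact ((lt_mem_nhds (h i)).filter_mono nhdsWithin_le_nhds).mono fun b hb => hb.le
    have h0 : ∀ᶠ b in 𝓝[<] (jsr A ^ 2), 0 ≤ b :=
      ((lt_mem_nhds (by positivity)).filter_mono nhdsWithin_le_nhds).mono fun b hb => hb.le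
    obtain ⟨b, ⟨h1, h2⟩, h3⟩ := ((h1.and h0).and self_mem_nhdsWithin).exists
    exact ⟨b, h2, h3, h1⟩
  have hlim : Tendsto (fun n : ℕ => (b / jsr A ^ 2) ^ n *
      ‖compound (1 : Matrix (Fin 2) (Fin 2) ℂ)‖) atTop (𝓝 0) := by
    simpa using (tendsto_pow_atTop_nhds_zero_of_lt_one (by positivity)
      ((div_lt_one (by positivity)).2 hb1)).mul_const
        ‖compound (1 : Matrix (Fin 2) (Fin 2) ℂ)‖
  obtain ⟨n, hlt, hn⟩ := ((hlim.eventually (gt_mem_nhds one_pos)).and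
    (eventually_ge_atTop 1)).exists
  refine rankOneProperty_of_norm_compound_lt hpos hK.self_of_nhds hn fun l hl => ?_
  rw [compound_fin_two, norm_smul]
  rw [div_pow, div_mul_eq_mul_div, div_lt_one (by positivity), ← pow_mul] at hlt
  refine lt_of_le_of_lt ?_ hlt
  rw [← hl]
  gcongr
  exact norm_det_listProd_le hb l

/-- The eigenvalues `a`, `c` of a complex `2 × 2` matrix, the larger one first. -/
theorem exists_eigenvalues_fin_two (M : Matrix (Fin 2) (Fin 2) ℂ) :
    ∃ a c : ℂ, ‖c‖ ≤ ‖a‖ ∧ M.trace = a + c ∧ M.det = a * c := by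
  obtain ⟨a, ha⟩ := exists_quadratic_eq_zero (a := (1 : ℂ)) (b := -M.trace) (c := M.det)
    one_ne_zero (by
      obtain ⟨s, hs⟩ := IsAlgClosed.exists_pow_nat_eq (discrim 1 (-M.trace) M.det) two_pos
      exact ⟨s, by rw [← hs, sq]⟩)
  rcases le_total ‖M.trace - a‖ ‖a‖ with h | h
  · exact ⟨a, M.trace - a, h, by ring, by linear_combination ha⟩
  · exact ⟨M.trace - a, a, h, by ring, by linear_combination ha⟩

theorem exists_mulVec_eq_smul_of_trace_of_det {M : Matrix (Fin 2) (Fin 2) ℂ} {a c : ℂ}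
    (htr : M.trace = a + c) (hdet : M.det = a * c) : ∃ v ≠ 0, M.mulVec v = a • v := by
  have h0 : (M - a • (1 : Matrix (Fin 2) (Fin 2) ℂ)).det = 0 := by
    rw [Matrix.trace_fin_two] at htr
    rw [Matrix.det_fin_two] at hdet ⊢
    simp
    linear_combination hdet - a * htr
  obtain ⟨v, hv, h⟩ := Matrix.exists_mulVec_eq_zero_iff.2 h0
  refine ⟨v, hv, ?_⟩
  rwa [Matrix.sub_mulVec, Matrix.smul_mulVec, Matrix.one_mulVec, sub_eq_zero] at h

theorem det_eq_of_mulVec_eq_smul {M : Matrix (Fin 2) (Fin 2) ℂ} {a : ℂ} {v : Fin 2 → ℂ}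
    (hv : v ≠ 0) (h : M.mulVec v = a • v) : M.det = a * (M.trace - a) := by
  have h0 : (M - a • (1 : Matrix (Fin 2) (Fin 2) ℂ)).det = 0 :=
    Matrix.exists_mulVec_eq_zero_iff.1 ⟨v, hv, by
      rw [Matrix.sub_mulVec, Matrix.smul_mulVec, Matrix.one_mulVec, h, sub_self]⟩
  rw [Matrix.det_fin_two] at h0 ⊢
  rw [Matrix.trace_fin_two]
  simp at h0
  linear_combination h0

/-- A direction `D` in which the modulus of the larger eigenvalue `a` of `M` grows at unit speed
while the smaller one `c` is unchanged: `D` is a rank one matrix fixing an eigenvector of `M`,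
times the phase `θ` of `a`. -/
theorem exists_eigenvalue_perturbation (M : Matrix (Fin 2) (Fin 2) ℂ) :
    ∃ (D : Matrix (Fin 2) (Fin 2) ℂ) (ρ κ : ℝ), 0 ≤ κ ∧ κ ≤ ρ ∧ ∀ t : ℝ, 0 ≤ t →
      ‖(M + t • D).det‖ = (ρ + t) * κ ∧
      ∃ a : ℂ, ‖a‖ = ρ + t ∧ ∃ v ≠ 0, (M + t • D).mulVec v = a • v := by
  obtain ⟨a, c, hca, htr, hdet⟩ := exists_eigenvalues_fin_two M
  obtain ⟨v, hv, hMv⟩ := exists_mulVec_eq_smul_of_trace_of_det htr hdet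
  obtain ⟨θ, hθ, haθ⟩ : ∃ θ : ℂ, ‖θ‖ = 1 ∧ a = ‖a‖ * θ := by
    rcases eq_or_ne a 0 with rfl | ha
    · exact ⟨1, by simp, by simp⟩
    · have h0 : (‖a‖ : ℂ) ≠ 0 := by simpa using ha
      exact ⟨a / ‖a‖, by simp [ha], by field_simp⟩
  obtain ⟨k, hk⟩ : ∃ k, v k ≠ 0 := Function.ne_iff.1 hv
  -- `φ` is a linear form with `φ v = 1`.
  set φ : Fin 2 → ℂ := Pi.single k (v k)⁻¹
  have hφ : φ ⬝ᵥ v = 1 := by simp [φ, hk]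
  set D := θ • Matrix.vecMulVec v φ with hD
  have hDv : D.mulVec v = θ • v := by
    rw [hD, Matrix.smul_mulVec, Matrix.vecMulVec_mulVec, hφ]
    simp
  have hDtr : D.trace = θ := by
    rw [hD, Matrix.trace_smul, Matrix.trace_vecMulVec, dotProduct_comm, hφ, smul_eq_mul, mul_one]
  refine ⟨D, ‖a‖, ‖c‖, norm_nonneg c, hca, fun t ht => ?_⟩
  have hreal : t • D = (t : ℂ) • D := RCLike.real_smul_eq_coe_smul (K := ℂ) t D
  have hev : (M + t • D).mulVec v = (a + t * θ) • v := by
    rw [Matrix.add_mulVec, hreal, Matrix.smul_mulVec, hMv, hDv, smul_smul, add_smul]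
  have hnorm : ‖a + t * θ‖ = ‖a‖ + t := by
    have h1 : a + t * θ = ((‖a‖ + t : ℝ) : ℂ) * θ := by
      push_cast
      linear_combination haθ
    rw [h1, norm_mul, hθ, mul_one, Complex.norm_real, Real.norm_of_nonneg (by positivity)]
  refine ⟨?_, a + t * θ, hnorm, v, hv, hev⟩
  rw [det_eq_of_mulVec_eq_smul hv hev, Matrix.trace_add, htr, hreal, Matrix.trace_smul, hDtr,
    smul_eq_mul, norm_mul, hnorm]
  congr 2
  ring

/-- Enlarging the leading eigenvalue of a matrix of maximal determinant makes the square of the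
joint spectral radius exceed all the determinants. -/
theorem IsIrreducibleTuple.mem_closure_rankOneProperty {r : ℕ} (hr : 1 ≤ r)
    {A : Fin r → Matrix (Fin 2) (Fin 2) ℂ} (hA : IsIrreducibleTuple A) :
    A ∈ closure {A' | IsIrreducibleTuple A' ∧ RankOneProperty A'} := by
  have : Nonempty (Fin r) := ⟨⟨0, hr⟩⟩
  obtain ⟨i, hi⟩ := Finite.exists_max fun i => ‖(A i).det‖
  obtain ⟨D, ρ, κ, hκ, hκρ, h⟩ := exists_eigenvalue_perturbation (A i)
  set F : ℝ → Fin r → Matrix (Fin 2) (Fin 2) ℂ := fun t => Function.update A i (A i + t • D) with hF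
  have hFcont : Continuous F := by
    have h1 : Continuous fun t : ℝ => A i + t • D :=
      continuous_const.add (continuous_id.smul continuous_const)
    exact continuous_const.update i h1
  have hF0 : Tendsto F (𝓝[>] 0) (𝓝 A) := by
    have h0 : F 0 = A := by simp [hF]
    have h1 := hFcont.tendsto 0
    rw [h0] at h1
    exact h1.mono_left nhdsWithin_le_nhds
  refine mem_closure_of_tendsto hF0 ?_
  filter_upwards [hF0.eventually (isOpen_irreducibleTuples.mem_nhds hA), self_mem_nhdsWithin]
    with t hirr ht
  have ht : 0 < t := ht
  obtain ⟨hdet, a, ha, v, hv, hev⟩ := h t ht.le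
  have hjsr : ρ + t ≤ jsr (F t) := by
    rw [← ha]
    exact norm_eigenvalue_le_jsr (F t) i hv (by simpa [hF] using hev)
  have hρ : 0 ≤ ρ := hκ.trans hκρ
  have hle : ∀ j, ‖(F t j).det‖ ≤ (ρ + t) * κ := by
    intro j
    rcases eq_or_ne j i with rfl | hj
    · simp [hF, hdet]
    · have h0 := (h 0 le_rfl).1
      simp only [zero_smul, add_zero] at h0
      simp only [hF, Function.update_of_ne hj]
      refine (hi j).trans ?_
      rw [h0]
      gcongr
      linarith
  refine ⟨hirr, IsIrreducibleTuple.rankOneProperty_of_norm_det_lt hirr (by linarith) fun j => ?_⟩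
  calc _ ≤ (ρ + t) * κ := hle j
    _ < (ρ + t) * (ρ + t) := by gcongr; linarith
    _ ≤ jsr (F t) ^ 2 := by rw [← sq]; gcongr

end Density

end JointSpectral

end

theorem proposition3 :
    (∀ (𝕜 : Type*) [RCLike 𝕜] (d r : ℕ), 1 ≤ d → 1 ≤ r →
      IsOpen {A : JointSpectral.irreducibleTuples 𝕜 r d |
        JointSpectral.RankOneProperty (A : Fin r → Matrix (Fin d) (Fin d) 𝕜)}) ∧
    (∀ r : ℕ, 1 ≤ r →
      Dense {A : JointSpectral.irreducibleTuples ℂ r 2 |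
        JointSpectral.RankOneProperty (A : Fin r → Matrix (Fin 2) (Fin 2) ℂ)}) := by
  refine ⟨fun 𝕜 _ d r _ _ => isOpen_iff_mem_nhds.2 ?_, fun r hr A => ?_⟩
  · rintro ⟨A, hA⟩ h
    exact continuous_subtype_val.continuousAt.eventually
      (JointSpectral.IsIrreducibleTuple.eventually_rankOneProperty hA h)
  · rw [closure_subtype]
    refine closure_mono ?_
      (JointSpectral.IsIrreducibleTuple.mem_closure_rankOneProperty hr A.2)
    rintro A' ⟨hirr, h⟩
    exact ⟨⟨A', hirr⟩, h, rfl⟩
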